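/- Let $k$ be a number field of class number $1$ with ring of integers $R$, let $a,b\in R$ be such that $ab$ is square-free, and let $A=\left(\frac{a,b}{k}\right)$ be the quaternion algebra over $k$ with basis $1,i,j,ij$, where $i^2=a$, $j^2=b$ and $ij=-ji$. Say that $A$ is ramified at a finite place $v$ of $k$ if $A\otimes_k k_v$ is a division algebra, and let $\Delta(A)$ be the product of the prime ideals of $R$ at which $A$ is ramified. Suppose that $\Delta(A)$ divides $abR$. For each prime ideal $\mathcal P$ of $R$ (nonzero) at which $A$ is not ramified, let $\pi_{\mathcal P}$ be a generator of $\mathcal P$, and put $$r=\begin{cases}1 & \text{if }\Delta(A)=abR,\\ \displaystyle\prod_{\mathcal P\mid abR,\ \mathcal P\nmid\Delta(A)}\pi_{\mathcal P} & \text{if }\Delta(A)\neq abR.\end{cases}$$ Let $\mathcal O'=R[1,i,j,ij]$ be the $R$-module spanned by $1,i,j,ij$. An order of $A$ is a subring with $1$ that is a finitely generated $R$-submodule of $A$ spanning $A$ over $k$; it is maximal if it is maximal among orders with respect to inclusion. If $\beta\in A$ is such that the ring $\mathcal O=\mathcal O'[\beta]$ generated by $\mathcal O'$ and $\beta$ is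 a maximal order of $A$, then $$\beta\in\frac{1}{2r}\,\mathcal O'.$$ -/

import Mathlib

open scoped NumberField TensorProduct Quaternion
open IsDedekindDomain

noncomputable section

namespace QuatOrder

/-- An order of a finite-dimensional `k`-algebra `A` over the ring of integers `R = 𝓞 k`: a subring
with `1` which is a complete `R`-lattice, that is, a finitely generated `R`-submodule
of `A` that spans `A` over `k`. -/
structure IsOrder (k : Type*) [Field k] {A : Type*} [Ring A] [Algebra k A]
    [Algebra (𝓞 k) A] (O : Subalgebra (𝓞 k) A) : Prop where
  fg : (Subalgebra.toSubmodule O).FG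
  span_eq_top : Submodule.span k (O : Set A) = ⊤

/-- A maximal order: an order that is maximal among orders with respect to inclusion. -/
def IsMaximalOrder (k : Type*) [Field k] {A : Type*} [Ring A] [Algebra k A]
    [Algebra (𝓞 k) A] (O : Subalgebra (𝓞 k) A) : Prop :=
  Maximal (fun O' : Subalgebra (𝓞 k) A => IsOrder k O') O

/-- The `k`-algebra `A` is ramified at the finite place `v` of `k` if `A ⊗ k_v`
is a division algebra. -/
def IsRamifiedAt (k : Type*) [Field k] [NumberField k] (A : Type*) [Ring A] [Algebra k A]
    (v : HeightOneSpectrum (𝓞 k)) : Prop :=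
  Nontrivial (A ⊗[k] v.adicCompletion k) ∧
    ∀ x : A ⊗[k] v.adicCompletion k, x ≠ 0 → IsUnit x

/-- The set of finite places of `k` at which `A` is ramified. -/
def ramFin (k : Type*) [Field k] [NumberField k] (A : Type*) [Ring A] [Algebra k A] :
    Set (HeightOneSpectrum (𝓞 k)) :=
  {v | IsRamifiedAt k A v}

/-- The discriminant of a quaternion algebra `A`: the product of the
prime ideals at which `A` is ramified (there are finitely many). -/
def discr (k : Type*) [Field k] [NumberField k] (A : Type*) [Ring A] [Algebra k A] :
    Ideal (𝓞 k) :=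
  ∏ᶠ v ∈ ramFin k A, v.asIdeal

section Standard

variable {k : Type*} [Field k] [NumberField k] (a b : 𝓞 k)

/-- The quaternion algebra with Hilbert symbol `(a, b / k)`, for `a b : 𝓞 k`: it has `k`-basis
`1, i, j, ij` with `i ^ 2 = a`, `j ^ 2 = b`, `i * j = - j * i`. -/
abbrev Quat : Type _ := ℍ[k, (a : k), (b : k)]

/-- The standard generator `i`. -/
def qi : Quat a b := ⟨0, 1, 0, 0⟩

/-- The standard generator `j`. -/
def qj : Quat a b := ⟨0, 0, 1, 0⟩

/-- The standard order `R[1, i, j, ij]`, the `R`-module spanned by `1, i, j, ij`. -/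
def stdOrder : Submodule (𝓞 k) (Quat a b) :=
  Submodule.span (𝓞 k) {1, qi a b, qj a b, qi a b * qj a b}

/-- The ring `R[1, i, j, ij][β]` generated by the standard order and `β`. -/
def stdOrderAdjoin (β : Quat a b) : Subalgebra (𝓞 k) (Quat a b) :=
  Algebra.adjoin (𝓞 k) ((stdOrder a b : Set (Quat a b)) ∪ {β})

open scoped Classical in
/-- For a choice `π v` of generators of the unramified primes: `1` if the discriminant is `abR`,
and otherwise the product of the `π v` over the primes `v` that divide `abR` but not the
discriminant. -/
def denomElt (π : HeightOneSpectrum (𝓞 k) → 𝓞 k) : 𝓞 k :=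
  if discr k (Quat a b) = Ideal.span {a * b} then 1
  else ∏ᶠ v ∈ {v : HeightOneSpectrum (𝓞 k) |
    v.asIdeal ∣ Ideal.span {a * b} ∧ ¬ v.asIdeal ∣ discr k (Quat a b)}, π v

end Standard

end QuatOrder

end

namespace QuatOrder

/-! Write `β = x₀ + x₁ i + x₂ j + x₃ ij`. Elements of an order are integral, so the reduced traces
of `β`, `iβ`, `jβ`, `-ijβ` lie in `R`; these are `c * 2xₘ` with `c = 1, a, b, ab`. It remains to
remove `c` at the cost of `r`, one prime `v ∣ c` at a time. Since `ab` is square-free, `v` divides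
`c` exactly once. If `v` is unramified, `r` supplies the missing factor (`denomElt_mem`). If `v` is
ramified, the norm of the product is `± c * nrd β`, which lies in `v`, and this forces its trace
into `v` (`trd_mem_of_isRamifiedAt`). `exists_denomElt_mul_eq` combines the cases. -/

/-- Hensel's lemma for `X ^ 2 - t X + n` with `t` a unit and `n` topologically nilpotent. -/
theorem exists_root_quadratic_of_norm_lt_one {K : Type*} [NormedField K] [CompleteSpace K] [IsUltrametricDist K]
    {t n : K} (ht : ‖t‖ = 1) (hn : ‖n‖ < 1) : ∃ r : K, r ^ 2 - t * r + n = 0 := by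
  have ht0 : t ≠ 0 := norm_ne_zero_iff.1 (by simp [ht])
  -- A root is a fixed point of `f`, which contracts the ball of radius `‖n‖` by the factor `‖n‖`.
  let f : K → K := fun x => (x ^ 2 + n) / t
  let u : ℕ → K := fun m => f^[m] 0
  have hu : ∀ m, u (m + 1) = (u m ^ 2 + n) / t := fun m => Function.iterate_succ_apply' f m 0
  have hb : ∀ m, ‖u m‖ ≤ ‖n‖ := by
    intro m
    induction m with
    | zero => simp [u]
    | succ m ih =>
      rw [hu, norm_div, ht, div_one]
      refine (IsUltrametricDist.norm_add_le_max _ _).trans (max_le ?_ le_rfl)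
      rw [norm_pow]
      nlinarith [norm_nonneg (u m), norm_nonneg n]
  have hd : ∀ m, dist (u m) (u (m + 1)) ≤ 1 * ‖n‖ ^ m := by
    intro m
    induction m with
    | zero =>
      have := hb 1
      simp only [dist_eq_norm, u, Function.iterate_zero, id, zero_sub, norm_neg]
      simpa only [pow_zero, mul_one] using this.trans hn.le
    | succ m ih =>
      rw [dist_eq_norm] at ih ⊢
      have : u (m + 1) - u (m + 1 + 1) = (u m + u (m + 1)) * (u m - u (m + 1)) / t := by
        rw [hu (m + 1)]; nth_rw 1 [hu m]; ring
      rw [this, norm_div, norm_mul, ht, div_one, pow_succ', one_mul]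
      have h2 : ‖u m + u (m + 1)‖ ≤ ‖n‖ :=
        (IsUltrametricDist.norm_add_le_max _ _).trans (max_le (hb _) (hb _))
      rw [one_mul] at ih
      gcongr
  obtain ⟨r, hr⟩ := cauchySeq_tendsto_of_complete (cauchySeq_of_le_geometric _ _ hn hd)
  refine ⟨r, ?_⟩
  have h1 : Filter.Tendsto (fun m => (u m ^ 2 + n) / t) Filter.atTop (nhds ((r ^ 2 + n) / t)) :=
    ((hr.pow 2).add_const n).div_const t
  have h2 : Filter.Tendsto (fun m => u (m + 1)) Filter.atTop (nhds r) :=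
    (Filter.tendsto_add_atTop_iff_nat 1).2 hr
  simp only [hu] at h2
  have h := tendsto_nhds_unique h1 h2
  field_simp at h
  linear_combination h

/-! ### Reduced norm, integrality and ramified places -/

variable {k : Type*} [Field k] {a b : 𝓞 k}

/-- The reduced norm of a quaternion. -/
def nrd (x : Quat a b) : k :=
  x.re ^ 2 - a * x.imI ^ 2 - b * x.imJ ^ 2 + a * b * x.imK ^ 2

theorem sq_sub_trd_mul_add_nrd (x : Quat a b) :
    x * x - (2 * x.re) • x + algebraMap k _ (nrd x) = 0 := by
  ext <;> simp [nrd, QuaternionAlgebra.algebraMap_eq] <;> ring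

/-- If `x ⊗ 1` is a scalar of the completed algebra, linear functionals killing `1` kill `x`. -/
theorem eq_zero_of_tmul_eq {K : Type*} [Field K] [Algebra k K] {x : Quat a b} {s : K}
    (h : x ⊗ₜ[k] (1 : K) = 1 ⊗ₜ[k] s) (f : Quat a b →ₗ[k] k) (hf : f 1 = 0) : f x = 0 := by
  have h' := congrArg (TensorProduct.lid k K) (congrArg (f.rTensor K) h)
  simpa [hf, Algebra.smul_def] using h'

theorem mk_mem_stdOrder (x₀ x₁ x₂ x₃ : 𝓞 k) :
    (⟨x₀, x₁, x₂, x₃⟩ : Quat a b) ∈ stdOrder a b := by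
  have h : (⟨x₀, x₁, x₂, x₃⟩ : Quat a b) =
      x₀ • 1 + x₁ • qi a b + x₂ • qj a b + x₃ • (qi a b * qj a b) := by
    ext <;> simp [qi, qj, Algebra.smul_def]
  rw [h]
  have hs : ∀ y ∈ ({1, qi a b, qj a b, qi a b * qj a b} : Set (Quat a b)), y ∈ stdOrder a b :=
    fun y hy => Submodule.subset_span hy
  refine add_mem (add_mem (add_mem ?_ ?_) ?_) ?_ <;>
    exact Submodule.smul_mem _ _ (hs _ (by simp))

variable [NumberField k]

/-- If `t` were a unit at `v`, Hensel would split the quadratic of `x` over `k_v`. A division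
algebra has no zero divisors, so `x` would be scalar, giving `t ^ 2 = 4 * n ∈ v`. -/
theorem trd_mem_of_isRamifiedAt {v : HeightOneSpectrum (𝓞 k)}
    (hv : IsRamifiedAt k (Quat a b) v) {x : Quat a b} {t n : 𝓞 k}
    (ht : 2 * x.re = t) (hn : nrd x = n) (hnv : n ∈ v.asIdeal) : t ∈ v.asIdeal := by
  by_contra htv
  have h1 := (NumberField.FinitePlace.norm_eq_one_iff_notMem k v t).2 htv
  have h2 := (NumberField.FinitePlace.norm_lt_one_iff_mem k v n).2 hnv
  obtain ⟨r, hr⟩ := exists_root_quadratic_of_norm_lt_one h1 h2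
  change r ^ 2 - algebraMap k _ (t : k) * r + algebraMap k _ (n : k) = 0 at hr
  rw [← ht, ← hn] at hr
  have hx := sq_sub_trd_mul_add_nrd x
  have hprod : (x ⊗ₜ[k] (1 : v.adicCompletion k) - 1 ⊗ₜ[k] r) *
      (x ⊗ₜ[k] 1 - 1 ⊗ₜ[k] (algebraMap k _ (2 * x.re) - r)) = 0 := by
    have e1 : (x * x) ⊗ₜ[k] (1 : v.adicCompletion k) =
        x ⊗ₜ[k] algebraMap k _ (2 * x.re) - 1 ⊗ₜ[k] algebraMap k _ (nrd x) := by
      rw [show x * x = (2 * x.re) • x - (nrd x) • 1 by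
        rw [Algebra.algebraMap_eq_smul_one] at hx
        rw [← sub_eq_zero, ← hx]; abel]
      rw [TensorProduct.sub_tmul, TensorProduct.smul_tmul, TensorProduct.smul_tmul,
        Algebra.algebraMap_eq_smul_one, Algebra.algebraMap_eq_smul_one]
    have e2 : algebraMap k (v.adicCompletion k) (nrd x) =
        r * (algebraMap k _ (2 * x.re) - r) := by linear_combination hr
    simp only [sub_mul, mul_sub, Algebra.TensorProduct.tmul_mul_tmul, one_mul, mul_one, e1, e2,
      TensorProduct.tmul_sub]
    abel
  have key : ∃ s : v.adicCompletion k, x ⊗ₜ[k] (1 : v.adicCompletion k) = 1 ⊗ₜ[k] s := by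
    by_cases h0 : x ⊗ₜ[k] (1 : v.adicCompletion k) - 1 ⊗ₜ[k] r = 0
    · exact ⟨r, sub_eq_zero.1 h0⟩
    · exact ⟨_, sub_eq_zero.1 (((hv.2 _ h0).mul_right_eq_zero).1 hprod)⟩
  obtain ⟨s, hs⟩ := key
  have hI : x.imI = 0 := eq_zero_of_tmul_eq hs (QuaternionAlgebra.imIₗ _ _ _) rfl
  have hJ : x.imJ = 0 := eq_zero_of_tmul_eq hs (QuaternionAlgebra.imJₗ _ _ _) rfl
  have hK : x.imK = 0 := eq_zero_of_tmul_eq hs (QuaternionAlgebra.imKₗ _ _ _) rfl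
  have hsq : t ^ 2 = 4 * n := by
    apply NumberField.RingOfIntegers.coe_injective
    have h4 : algebraMap (𝓞 k) k 4 = 4 := map_ofNat _ 4
    rw [map_pow, map_mul, h4]
    change (t : k) ^ 2 = 4 * (n : k)
    rw [← ht, ← hn, nrd, hI, hJ, hK]
    ring
  exact htv (v.isPrime.mem_of_pow_mem 2 (hsq ▸ v.asIdeal.mul_mem_left 4 hnv))

/-- Reduced trace and norm of an integral quaternion are integral. -/
theorem exists_trd_nrd_of_isIntegral {x : Quat a b} (hx : IsIntegral (𝓞 k) x) :
    (∃ t : 𝓞 k, 2 * x.re = t) ∧ ∃ n : 𝓞 k, nrd x = n := by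
  open Polynomial in
  obtain ⟨p, hp, hpx⟩ := hx
  by_cases hs : ∃ c : k, x = algebraMap k _ c
  -- A scalar has a linear minimal polynomial, so the quadratic `q` below need not divide `p`.
  · obtain ⟨c, rfl⟩ := hs
    have hc : IsIntegral (𝓞 k) c := by
      refine ⟨p, hp, (algebraMap k (Quat a b)).injective ?_⟩
      rw [map_zero, ← hpx, Polynomial.hom_eval₂, ← IsScalarTower.algebraMap_eq]
    obtain ⟨d, rfl⟩ := IsIntegrallyClosed.isIntegral_iff.1 hc
    have h2 : algebraMap (𝓞 k) k 2 = 2 := map_ofNat _ 2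
    exact ⟨⟨2 * d, ((map_mul (algebraMap (𝓞 k) k) 2 d).trans (by rw [h2]; rfl)).symm⟩, ⟨d ^ 2, by simp [nrd]⟩⟩
  · let q : k[X] := X ^ 2 + (C (-(2 * x.re)) * X + C (nrd x))
    have hdeg : (C (-(2 * x.re)) * X + C (nrd x) : k[X]).degree < (2 : ℕ) :=
      degree_linear_lt
    have hq : q.Monic := monic_X_pow_add hdeg
    have hqd : q.degree = (2 : ℕ) := by
      rw [← degree_X_pow (R := k)] at hdeg
      rw [degree_add_eq_left_of_degree_lt hdeg, degree_X_pow]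
    have hqx : aeval x q = 0 := by
      have := sq_sub_trd_mul_add_nrd x
      rw [Algebra.smul_def] at this
      simp only [q, map_add, aeval_X, aeval_C, map_mul (aeval x), map_pow, neg_mul, map_neg]
      rw [← this, pow_two]
      abel
    have hpx' : aeval x (p.map (algebraMap (𝓞 k) k)) = 0 := by
      rw [aeval_map_algebraMap]; exact hpx
    have hdvd : q ∣ p.map (algebraMap (𝓞 k) k) := by
      rw [← modByMonic_eq_zero_iff_dvd hq]
      set m := p.map (algebraMap (𝓞 k) k) %ₘ q with hm
      have hmx : aeval x m = 0 := by
        have := modByMonic_add_div (p.map (algebraMap (𝓞 k) k)) q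
        rw [← this, map_add, map_mul, hqx, zero_mul, add_zero] at hpx'
        exact hpx'
      have hmd : m.degree ≤ 1 := by
        have := degree_modByMonic_lt (p.map (algebraMap (𝓞 k) k)) hq
        rw [hqd] at this
        exact Order.le_of_lt_succ this
      rw [eq_X_add_C_of_degree_le_one hmd] at hmx ⊢
      generalize m.coeff 1 = c at *
      generalize m.coeff 0 = d at *
      simp only [map_add, map_mul, aeval_X, aeval_C] at hmx
      have hc : c = 0 := by
        by_contra hc
        refine hs ⟨-(c⁻¹ * d), ?_⟩
        have h := congrArg (algebraMap k (Quat a b) c⁻¹ * ·) hmx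
        simp only [mul_add, ← mul_assoc, ← map_mul, inv_mul_cancel₀ hc, map_one, one_mul,
          mul_zero] at h
        rw [map_neg]
        exact eq_neg_of_add_eq_zero_left h
      subst hc
      have hd : d = 0 := (algebraMap k (Quat a b)).injective
        (by simpa only [map_zero, zero_mul, zero_add] using hmx)
      simp [hd]
    -- Gauss's lemma: a monic factor of a monic integral polynomial is integral.
    obtain ⟨g, hg⟩ := IsIntegrallyClosed.eq_map_mul_C_of_dvd k hp hdvd
    rw [hq.leadingCoeff, C_1, mul_one] at hg
    have h0 : q.coeff 0 = nrd x := by simp [q]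
    have h1 : q.coeff 1 = -(2 * x.re) := by simp [q, coeff_X_pow, coeff_C]
    rw [← hg, coeff_map] at h0 h1
    exact ⟨⟨-g.coeff 1, by push_cast; linear_combination h1⟩, ⟨g.coeff 0, h0.symm⟩⟩

/-- Otherwise `a y² + b z² = 1` is solvable in the residue field, and `1 + y i + z j` has norm in
`v` but trace `2` outside it. This gives finiteness of `ramFin`, without which the `finprod` in
`discr` could take its default value `1`. -/
theorem mem_of_isRamifiedAt {v : HeightOneSpectrum (𝓞 k)} (hv : IsRamifiedAt k (Quat a b) v) :
    2 * a * b ∈ v.asIdeal := by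
  by_contra hab
  have h2 : (2 : 𝓞 k) ∉ v.asIdeal := fun h =>
    hab (by rw [mul_assoc]; exact Ideal.mul_mem_right _ _ h)
  have ha : a ∉ v.asIdeal := fun h =>
    hab (Ideal.mul_mem_right _ _ (Ideal.mul_mem_left _ _ h))
  have hb : b ∉ v.asIdeal := fun h => hab (Ideal.mul_mem_left _ _ h)
  have := v.isMaximal
  let : Field (𝓞 k ⧸ v.asIdeal) := Ideal.Quotient.field v.asIdeal
  have : Finite (𝓞 k ⧸ v.asIdeal) := v.asIdeal.finiteQuotientOfFreeOfNeBot v.ne_bot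
  let := Fintype.ofFinite (𝓞 k ⧸ v.asIdeal)
  let φ := Ideal.Quotient.mk v.asIdeal
  have hφ : ∀ {y}, φ y = 0 ↔ y ∈ v.asIdeal := Ideal.Quotient.eq_zero_iff_mem
  have hodd : Fintype.card (𝓞 k ⧸ v.asIdeal) % 2 = 1 := by
    refine FiniteField.odd_card_of_char_ne_two fun h => h2 (hφ.1 ?_)
    have := ringChar.Nat.cast_ringChar (R := 𝓞 k ⧸ v.asIdeal)
    rw [h] at this
    simpa only [Nat.cast_ofNat, map_ofNat] using this
  open Polynomial in
  obtain ⟨y, z, hyz⟩ := FiniteField.exists_root_sum_quadratic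
    (f := C (φ a) * X ^ 2 + C 0 * X + C 0) (g := C (φ b) * X ^ 2 + C 0 * X + C (-1))
    (degree_quadratic (fun h => ha (hφ.1 h))) (degree_quadratic (fun h => hb (hφ.1 h))) hodd
  obtain ⟨y, rfl⟩ := Ideal.Quotient.mk_surjective y
  obtain ⟨z, rfl⟩ := Ideal.Quotient.mk_surjective z
  refine h2 (trd_mem_of_isRamifiedAt hv (x := ⟨1, y, z, 0⟩) (t := 2)
    (n := 1 - a * y ^ 2 - b * z ^ 2) ((mul_one _).trans (map_ofNat (algebraMap (𝓞 k) k) 2).symm)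
    (by simp [nrd]) (hφ.1 ?_))
  simp only [Polynomial.eval_add, Polynomial.eval_mul, Polynomial.eval_C, Polynomial.eval_X,
    Polynomial.eval_pow] at hyz
  simp only [map_sub, map_one, map_mul, map_pow]
  linear_combination -hyz

/-! ### The discriminant and the denominator `r` -/

theorem finite_ramFin (hab : a * b ≠ 0) : (ramFin k (Quat a b)).Finite := by
  refine (Ideal.finite_factors (I := Ideal.span {2 * a * b}) ?_).subset fun v hv =>
    Ideal.dvd_span_singleton.2 (mem_of_isRamifiedAt hv)
  rw [Ideal.zero_eq_bot, Ne, Ideal.span_singleton_eq_bot, mul_assoc]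
  exact mul_ne_zero two_ne_zero hab

theorem dvd_discr_iff (hab : a * b ≠ 0) (v : HeightOneSpectrum (𝓞 k)) :
    v.asIdeal ∣ discr k (Quat a b) ↔ v ∈ ramFin k (Quat a b) := by
  rw [discr, finprod_mem_eq_finite_toFinset_prod _ (finite_ramFin hab),
    v.prime.dvd_finsetProd_iff]
  constructor
  · rintro ⟨w, hw, hvw⟩
    have : v = w := HeightOneSpectrum.ext
      (w.isMaximal.eq_of_le v.isPrime.ne_top (Ideal.dvd_iff_le.1 hvw)).symm
    exact this ▸ (finite_ramFin hab).mem_toFinset.1 hw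
  · exact fun h => ⟨v, (finite_ramFin hab).mem_toFinset.2 h, dvd_rfl⟩

variable {π : HeightOneSpectrum (𝓞 k) → 𝓞 k}

theorem denomElt_ne_zero (hab : a * b ≠ 0)
    (hπ : ∀ v, v ∉ ramFin k (Quat a b) → Ideal.span {π v} = v.asIdeal) :
    denomElt a b π ≠ 0 := by
  unfold denomElt
  split_ifs
  · exact one_ne_zero
  · refine finprod_mem_induction (· ≠ 0) one_ne_zero (fun _ _ => mul_ne_zero) fun v hv h0 => ?_
    have := hπ v fun h => hv.2 ((dvd_discr_iff hab v).2 h)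
    rw [h0, Ideal.span_singleton_zero] at this
    exact v.ne_bot this.symm

theorem denomElt_mem (hab : a * b ≠ 0)
    (hπ : ∀ v, v ∉ ramFin k (Quat a b) → Ideal.span {π v} = v.asIdeal)
    {v : HeightOneSpectrum (𝓞 k)} (hv : v ∉ ramFin k (Quat a b)) (habv : a * b ∈ v.asIdeal) :
    denomElt a b π ∈ v.asIdeal := by
  have hd := mt (dvd_discr_iff hab v).1 hv
  have hdvd := Ideal.dvd_span_singleton.2 habv
  unfold denomElt
  split_ifs with h
  · exact absurd (h ▸ hdvd) hd
  · have hfin : {v : HeightOneSpectrum (𝓞 k) | v.asIdeal ∣ Ideal.span {a * b} ∧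
        ¬ v.asIdeal ∣ discr k (Quat a b)}.Finite :=
      (Ideal.finite_factors (by simpa [Ideal.zero_eq_bot] using hab)).subset fun _ h => h.1
    rw [finprod_mem_eq_finite_toFinset_prod _ hfin]
    refine Ideal.mem_of_dvd _ (Finset.dvd_prod_of_mem _ (hfin.mem_toFinset.2 ⟨hdvd, hd⟩)) ?_
    rw [← hπ v hv]
    exact Ideal.mem_span_singleton_self _

/-- The local bound for one coordinate: `c` is one of `a`, `b`, `ab`. -/
theorem exists_denomElt_mul_eq [IsPrincipalIdealRing (𝓞 k)] (hab : Squarefree (a * b))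
    (hπ : ∀ v, v ∉ ramFin k (Quat a b) → Ideal.span {π v} = v.asIdeal)
    {c t : 𝓞 k} {y : k} (hc : c ∣ a * b) (hy : c * y = t)
    (hram : ∀ v ∈ ramFin k (Quat a b), c ∈ v.asIdeal → t ∈ v.asIdeal) :
    ∃ z : 𝓞 k, denomElt a b π * y = z := by
  suffices h : ∀ v : HeightOneSpectrum (𝓞 k), v.valuation k (denomElt a b π * y) ≤ 1 by
    obtain ⟨z, hz⟩ := HeightOneSpectrum.mem_integers_of_valuation_le_one k _ h
    exact ⟨z, hz.symm⟩
  intro v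
  have hc0 : c ≠ 0 := ne_zero_of_dvd_ne_zero hab.ne_zero hc
  have hvc0 : 0 < v.valuation k (c : k) := by
    rw [zero_lt_iff, Valuation.ne_zero_iff]
    exact_mod_cast hc0
  have hvy : v.valuation k (c : k) * v.valuation k y = v.valuation k (t : k) := by
    rw [← map_mul, hy]
  rw [map_mul]
  have hr1 : v.valuation k (denomElt a b π : k) ≤ 1 := v.valuation_le_one _
  by_cases hcv : c ∈ v.asIdeal
  -- With `p` a generator of `v`, `p * p ∣ c` would contradict square-freeness of `ab`.
  · have hlow : WithZero.exp (-1 : ℤ) ≤ v.valuation k (c : k) := by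
      change _ ≤ v.valuation k (algebraMap (𝓞 k) k c)
      rw [HeightOneSpectrum.valuation_of_algebraMap]
      refine (v.exp_le_intValuation_iff_emultiplicity_le (n := 1)).2 ?_
      obtain ⟨p, hp⟩ := IsPrincipalIdealRing.principal v.asIdeal
      rw [← Order.lt_add_one_iff_of_not_isMax (by simp), ← Nat.cast_one (R := ℕ∞), ← Nat.cast_add,
        emultiplicity_lt_iff_not_dvd, hp, Ideal.submodule_span_eq, Ideal.span_singleton_pow,
        Ideal.span_singleton_dvd_span_singleton_iff_dvd, pow_two]
      intro hpc
      refine v.isPrime.ne_top ?_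
      rw [hp, Ideal.submodule_span_eq, Ideal.span_singleton_eq_top]
      exact hab p (hpc.trans hc)
    have hup : ∀ s ∈ v.asIdeal, v.valuation k (s : k) ≤ v.valuation k (c : k) := by
      intro s hs
      refine le_trans ?_ hlow
      change v.valuation k (algebraMap (𝓞 k) k s) ≤ _
      rw [HeightOneSpectrum.valuation_of_algebraMap]
      exact (v.intValuation_le_pow_iff_mem s 1).2 (by rwa [pow_one])
    by_cases hv : v ∈ ramFin k (Quat a b)
    · refine mul_le_one' hr1 ?_
      refine le_of_mul_le_mul_left ?_ hvc0
      rw [hvy, mul_one]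
      exact hup t (hram v hv hcv)
    · calc _ ≤ v.valuation k (c : k) * v.valuation k y := by
            gcongr
            exact hup _ (denomElt_mem hab.ne_zero hπ hv (Ideal.mem_of_dvd _ hc hcv))
        _ ≤ 1 := hvy ▸ v.valuation_le_one t
  · have : v.valuation k (c : k) = 1 := (v.valuation_eq_one_iff_notMem (K := k)).2 hcv
    rw [this, one_mul] at hvy
    exact mul_le_one' hr1 (hvy ▸ v.valuation_le_one t)

end QuatOrder

theorem mainTheorem4 (k : Type*) [Field k] [NumberField k]
    (hk : NumberField.classNumber k = 1)
    (a b : 𝓞 k) (hab : Squarefree (a * b))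
    (hdisc : QuatOrder.discr k (QuatOrder.Quat a b) ∣ Ideal.span {a * b})
    (π : HeightOneSpectrum (𝓞 k) → 𝓞 k)
    (hπ : ∀ v, v ∉ QuatOrder.ramFin k (QuatOrder.Quat a b) → Ideal.span {π v} = v.asIdeal)
    (β : QuatOrder.Quat a b)
    (hβ : QuatOrder.IsMaximalOrder k (QuatOrder.stdOrderAdjoin a b β)) :
    ∃ x ∈ QuatOrder.stdOrder a b,
      β = (1 / (2 * (QuatOrder.denomElt a b π : k))) • x := by
  open QuatOrder in
  have := NumberField.classNumber_eq_one_iff.1 hk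
  have hO := hβ.prop
  have hint : ∀ x ∈ stdOrderAdjoin a b β, IsIntegral (𝓞 k) x := fun x hx =>
    IsIntegral.of_mem_of_fg _ hO.fg x hx
  have hβO : β ∈ stdOrderAdjoin a b β := Algebra.subset_adjoin (Or.inr rfl)
  have hsO : ∀ x ∈ stdOrder a b, x ∈ stdOrderAdjoin a b β := fun x hx =>
    Algebra.subset_adjoin (Or.inl hx)
  obtain ⟨n, hn⟩ := (exists_trd_nrd_of_isIntegral (hint β hβO)).2
  -- Here `s` is the reduced norm of `g`, equal to `c` up to sign.
  have coord : ∀ (c s : 𝓞 k) (g : Quat a b) (y : k), c ∣ a * b → g ∈ stdOrder a b →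
      nrd (g * β) = s * nrd β → (c ∣ s) → 2 * (g * β).re = c * (2 * y) →
      ∃ z : 𝓞 k, denomElt a b π * (2 * y) = z := by
    intro c s g y hc hg hnrd hcs htrd
    obtain ⟨t, ht⟩ := (exists_trd_nrd_of_isIntegral
      (hint (g * β) (mul_mem (hsO g hg) hβO))).1
    refine exists_denomElt_mul_eq hab hπ hc (htrd.symm.trans ht) fun v hv hcv => ?_
    refine trd_mem_of_isRamifiedAt hv ht (n := s * n) (by rw [hnrd, hn]; simp) ?_
    exact Ideal.mul_mem_right _ _ (Ideal.mem_of_dvd _ hcs hcv)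
  obtain ⟨z₀, h₀⟩ := coord 1 1 1 β.re (one_dvd _) (Submodule.subset_span (by simp))
    (by simp) dvd_rfl (by simp)
  obtain ⟨z₁, h₁⟩ := coord a (-a) ⟨0, 1, 0, 0⟩ β.imI (dvd_mul_right _ _)
    (by simpa using mk_mem_stdOrder (a := a) (b := b) 0 1 0 0)
    (by simp [nrd]; ring) (by simp) (by simp; ring)
  obtain ⟨z₂, h₂⟩ := coord b (-b) ⟨0, 0, 1, 0⟩ β.imJ (dvd_mul_left _ _)
    (by simpa using mk_mem_stdOrder (a := a) (b := b) 0 0 1 0)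
    (by simp [nrd]; ring) (by simp) (by simp; ring)
  -- The sign in `-ij` compensates for `(ij)² = -ab`.
  obtain ⟨z₃, h₃⟩ := coord (a * b) (a * b) ⟨0, 0, 0, -1⟩ β.imK dvd_rfl
    (by simpa using mk_mem_stdOrder (a := a) (b := b) 0 0 0 (-1))
    (by simp [nrd]; ring) dvd_rfl (by simp; ring)
  refine ⟨_, mk_mem_stdOrder z₀ z₁ z₂ z₃, ?_⟩
  have hr : (denomElt a b π : k) ≠ 0 := by exact_mod_cast denomElt_ne_zero hab.ne_zero hπ
  ext <;> simp [← h₀, ← h₁, ← h₂, ← h₃] <;> field_simp
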